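/- Let $G$ be a finite simple unicyclic graph, i.e. $G$ is connected and contains exactly one cycle $C$. For $v\in V(C)$ let the pendant tree $G\{v\}$ be the largest connected induced subgraph of $G$ that contains $v$ and no other vertex of $C$. For a finite graph $H$ with real adjacency matrix $A(H)$, call $H$ singular if $A(H)$ is singular, and let $\mathrm{Supp}(H)$ be the set of vertices $u$ of $H$ such that $x_u\neq 0$ for some real vector $x$ with $A(H)x=0$. Write $G-G\{v\}$ and $G-C$ for the subgraphs of $G$ induced by $V(G)\setminus V(G\{v\})$ and $V(G)\setminus V(C)$. Then $G$ is singular if and only if one of the following holds: (i) there is a vertex $v\in V(C)$ such that $v\notin\mathrm{Supp}(G\{v\})$ and at least one of $G\{v\}$ and $G-G\{v\}$ has no perfect matching; (ii) for every $v\in V(C)$ one has $v\in\mathrm{Supp}(G\{v\})$, and either some connected component (tree) of the forest $G-C$ has no perfect matching or the length of $C$ is divisible by $4$ (or both). -/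

import Mathlib

namespace SimpleGraph

variable {V : Type*}

/-- The null space of the real adjacency matrix of a finite graph. -/
noncomputable def nullSpace [Finite V] (G : SimpleGraph V) : Submodule ℝ (V → ℝ) :=
  letI := Fintype.ofFinite V
  letI := Classical.decRel G.Adj
  LinearMap.ker (G.adjMatrix ℝ).mulVecLin

/-- `Supp(G)`: the vertices at which some vector of the null space is nonzero. -/
def nullSupport [Finite V] (G : SimpleGraph V) : Set V :=
  ⋃ x ∈ G.nullSpace, Function.support x

/-- A finite graph is singular if its real adjacency matrix is singular. -/
def IsSingular [Finite V] (G : SimpleGraph V) : Prop :=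
  letI := Fintype.ofFinite V
  letI := Classical.decEq V
  letI := Classical.decRel G.Adj
  (G.adjMatrix ℝ).det = 0

/-- The graph has a perfect matching. -/
def HasPerfectMatching (G : SimpleGraph V) : Prop :=
  ∃ M : G.Subgraph, M.IsPerfectMatching

/-- The subgraph `C` of `G` is a cycle, i.e. it is traced out by a closed walk that is a cycle. -/
def Subgraph.IsCycleGraph {G : SimpleGraph V} (C : G.Subgraph) : Prop :=
  ∃ (u : V) (p : G.Walk u u), p.IsCycle ∧ p.toSubgraph = C

/-- A graph is unicyclic if it is connected and contains exactly one cycle. -/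
def IsUnicyclic (G : SimpleGraph V) : Prop :=
  G.Connected ∧ ∃! C : G.Subgraph, C.IsCycleGraph

/-- The vertex set of the pendant tree `G{v}`: the vertices that can be reached from `v` by a walk
meeting `C` only in `v`. The fact `isGreatest_pendantVerts` says that it is the largest vertex set
that contains `v` and no other vertex of `C` and induces a connected subgraph. -/
def pendantVerts (G : SimpleGraph V) (C : G.Subgraph) (v : V) : Set V :=
  {w | ∃ p : G.Walk v w, ∀ x ∈ p.support, x ∈ C.verts → x = v}

theorem mem_pendantVerts_self (G : SimpleGraph V) (C : G.Subgraph) (v : V) :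
    v ∈ G.pendantVerts C v :=
  ⟨Walk.nil, by simp⟩

theorem isGreatest_pendantVerts (G : SimpleGraph V) (C : G.Subgraph) (v : V) :
    IsGreatest {S : Set V | v ∈ S ∧ (∀ x ∈ S, x ∈ C.verts → x = v) ∧ (G.induce S).Connected}
      (G.pendantVerts C v) := by
  classical
  refine ⟨⟨G.mem_pendantVerts_self C v, ?_, ?_⟩, ?_⟩
  · rintro x ⟨p, hp⟩ hx
    exact hp x p.end_mem_support hx
  · refine induce_connected_of_patches v (G.mem_pendantVerts_self C v) ?_
    rintro w ⟨p, hp⟩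
    refine ⟨{x | x ∈ p.support}, ?_, p.start_mem_support, p.end_mem_support, ?_⟩
    · intro x hx
      exact ⟨p.takeUntil x hx, fun y hy => hp y (p.support_takeUntil_subset_support hx hy)⟩
    · exact p.connected_induce_support.preconnected _ _
  · rintro S ⟨hv, hS, hc⟩ w hw
    obtain ⟨q⟩ := hc.preconnected ⟨v, hv⟩ ⟨w, hw⟩
    refine ⟨q.map (Embedding.induce S).toHom, fun x hx => hS x ?_⟩
    have h := Walk.support_map (Embedding.induce (G := G) S).toHom q
    obtain ⟨y, -, rfl⟩ := List.mem_map.1 ((congrArg (x ∈ ·) h).mp hx)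
    exact y.2

/-- The pendant tree `G{v}` of `G` at the vertex `v` of the cycle `C`. -/
def pendantTree (G : SimpleGraph V) (C : G.Subgraph) (v : V) :
    SimpleGraph (G.pendantVerts C v) :=
  G.induce (G.pendantVerts C v)

/-- The vertex `v`, as a vertex of `G{v}`. -/
def pendantRoot (G : SimpleGraph V) (C : G.Subgraph) (v : V) : G.pendantVerts C v :=
  ⟨v, G.mem_pendantVerts_self C v⟩

end SimpleGraph

/-!
If the columns of `A(G)` indexed by a set `S` of vertices can be corrected, using the columns
outside `S`, so that they vanish outside `S` and are unchanged on `S`, then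
`det A(G) = det A(G[S]) * det A(G - S)`.

Such corrections exist in two situations. If a bipartite graph `H` is attached to the rest of `G`
at `v` and `v ∉ Supp(H)`, then `A(H) y = e_v` is solvable with `y_v = 0`, and multiples of `y` clear
the edges between `v` and the vertices outside `H`. If a graph is attached at every vertex `v` of a
set `D` and `v` always lies in its support, then its null vector with value `1` at `v` has, under
`A(G)`, the same image on `D` as `e_v` and image zero elsewhere.

Splitting off a leaf with its neighbour, an instance of the first situation, shows that a forest is
singular exactly when it has no perfect matching. The two cases of the theorem are the two
situations for the pendant trees, and a null vector of a cycle satisfies `x_{i+2} = -x_i`, which has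
a nonzero periodic solution exactly when the period is divisible by four.
-/

namespace SingularGraph

open SimpleGraph Matrix

section LinearAlgebra

theorem det_eq_mul_of_forall_exists_mulVec {n R : Type*} [Fintype n] [DecidableEq n] [CommRing R]
    {M : Matrix n n R} {S T : Set n} [DecidablePred (· ∈ S)] [DecidablePred (· ∈ T)]
    (hST : IsCompl S T)
    (h : ∀ j ∈ S, ∃ z : n → R, Set.EqOn z (Pi.single j 1) S ∧
      M *ᵥ z = S.indicator (M *ᵥ Pi.single j 1)) :
    M.det = (M.submatrix (Subtype.val : S → n) Subtype.val).det *
      (M.submatrix (Subtype.val : T → n) Subtype.val).det := by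
  classical
  obtain rfl := hST.compl_eq
  choose! z hzS hMz using h
  -- Both `U` and `M * U` are block triangular, with identity diagonal blocks in `U`.
  let U : Matrix n n R := of fun i j => if j ∈ S then z j i else (Pi.single j 1 : n → R) i
  have hMU (i j : n) : (M * U) i j = if j ∈ S then S.indicator (M.col j) i else M i j := by
    change (M *ᵥ U.col j) i = _
    by_cases hj : j ∈ S
    · have hU : U.col j = z j := funext fun i => if_pos hj
      rw [hU, hMz j hj, mulVec_single_one, if_pos hj]
    · have hU : U.col j = Pi.single j 1 := funext fun i => if_neg hj
      rw [hU, mulVec_single_one, if_neg hj, col_apply]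
  have hUdet : U.det = 1 := by
    have hS : U.toSquareBlockProp (· ∈ S) = 1 := by
      ext i j
      simp [U, toSquareBlockProp_def, hzS j j.2 i.2, one_apply, Pi.single_apply, Subtype.ext_iff]
    have hT : (U.toSquareBlockProp fun i => ¬ i ∈ S) = 1 := by
      ext i j
      simp [U, toSquareBlockProp_def, j.2, one_apply, Pi.single_apply, Subtype.ext_iff]
    rw [U.twoBlockTriangular_det' (· ∈ S), hS, hT, det_one, det_one, one_mul]
    intro i hi j hj
    simp [U, hj, ne_of_mem_of_not_mem hi hj]
  have hS : (M * U).toSquareBlockProp (· ∈ S) = M.submatrix Subtype.val Subtype.val := by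
    ext i j
    simp [toSquareBlockProp_def, hMU]
  have hT : (M * U).toSquareBlockProp (fun i => ¬ i ∈ S) = M.submatrix Subtype.val Subtype.val := by
    ext i j
    simp [toSquareBlockProp_def, hMU, j.2]
  rw [← mul_one M.det, ← hUdet, ← det_mul,
    (M * U).twoBlockTriangular_det (· ∈ S) fun i hi j hj => by simp [hMU, hi, hj], hS, hT]
  convert! rfl

theorem exists_vecMul_eq_single {m n K : Type*} [Fintype m] [Fintype n] [DecidableEq n] [Field K]
    {M : Matrix m n K} {i : n} (h : ∀ x, M *ᵥ x = 0 → x i = 0) :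
    ∃ y, y ᵥ* M = Pi.single i 1 := by
  classical
  have hmem : LinearMap.proj i ∈ (LinearMap.ker M.mulVecLin).dualAnnihilator :=
    (Submodule.mem_dualAnnihilator _).2 h
  rw [← LinearMap.range_dualMap_eq_dualAnnihilator_ker] at hmem
  obtain ⟨g, hg⟩ := hmem
  obtain ⟨y, rfl⟩ := (dotProductEquiv K m).surjective g
  refine ⟨y, dotProduct_eq _ _ fun x => ?_⟩
  rw [← dotProduct_mulVec, single_one_dotProduct]
  exact LinearMap.congr_fun hg x

end LinearAlgebra

section Singular

variable {V W K : Type*}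

/-- The graph is singular over `K`: its adjacency matrix with entries in `K` has determinant zero.
Over `ℝ` this is `SimpleGraph.IsSingular`. -/
def IsSingularOver (K : Type*) [CommRing K] [Finite V] (G : SimpleGraph V) : Prop :=
  letI := Fintype.ofFinite V
  letI := Classical.decEq V
  letI := Classical.decRel G.Adj
  (G.adjMatrix K).det = 0

/-- The vertices at which some null vector with entries in `K` is nonzero. Over `ℝ` this is
`SimpleGraph.nullSupport`. -/
def nullSupportOver (K : Type*) [CommRing K] [Finite V] (G : SimpleGraph V) : Set V :=
  letI := Fintype.ofFinite V
  letI := Classical.decRel G.Adj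
  ⋃ x ∈ LinearMap.ker (G.adjMatrix K).mulVecLin, Function.support x

theorem isSingularOver_iff_det_eq_zero [CommRing K] [Fintype V] [DecidableEq V]
    (G : SimpleGraph V) [DecidableRel G.Adj] :
    IsSingularOver K G ↔ (G.adjMatrix K).det = 0 := by
  unfold IsSingularOver
  convert Iff.rfl

theorem mem_nullSupportOver_iff [CommRing K] [Fintype V] {G : SimpleGraph V} [DecidableRel G.Adj]
    {v : V} : v ∈ nullSupportOver K G ↔ ∃ x, G.adjMatrix K *ᵥ x = 0 ∧ x v ≠ 0 := by
  simp only [nullSupportOver, Set.mem_iUnion, LinearMap.mem_ker, mulVecLin_apply,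
    Function.mem_support, exists_prop]
  refine exists_congr fun x => and_congr_left fun _ => ?_
  convert Iff.rfl
  rfl

theorem isSingularOver_iff_exists_mulVec_eq_zero [CommRing K] [IsDomain K] [Fintype V]
    (G : SimpleGraph V) [DecidableRel G.Adj] :
    IsSingularOver K G ↔ ∃ x ≠ 0, G.adjMatrix K *ᵥ x = 0 := by
  classical
  rw [isSingularOver_iff_det_eq_zero, exists_mulVec_eq_zero_iff]

theorem isSingularOver_of_mem_nullSupportOver [CommRing K] [IsDomain K] [Finite V]
    {G : SimpleGraph V} {v : V} (hv : v ∈ nullSupportOver K G) : IsSingularOver K G := by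
  classical
  cases nonempty_fintype V
  obtain ⟨x, hx, hxv⟩ := mem_nullSupportOver_iff.1 hv
  exact (isSingularOver_iff_exists_mulVec_eq_zero G).2 ⟨x, ne_of_apply_ne (· v) hxv, hx⟩

theorem isSingularOver_congr [CommRing K] [Finite V] [Finite W] {G : SimpleGraph V}
    {H : SimpleGraph W} (f : G ≃g H) : IsSingularOver K G ↔ IsSingularOver K H := by
  classical
  cases nonempty_fintype V
  cases nonempty_fintype W
  rw [isSingularOver_iff_det_eq_zero, isSingularOver_iff_det_eq_zero, ← f.reindex_adjMatrix K,
    det_reindex_self]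

theorem isSingularOver_iff_or_of_forall_exists_mulVec [CommRing K] [IsDomain K] [Fintype V]
    [DecidableEq V] {G : SimpleGraph V} [DecidableRel G.Adj] {S T : Set V} (hST : IsCompl S T)
    (h : ∀ v ∈ S, ∃ z : V → K, Set.EqOn z (Pi.single v 1) S ∧
      G.adjMatrix K *ᵥ z = S.indicator (G.adjMatrix K *ᵥ Pi.single v 1)) :
    IsSingularOver K G ↔ IsSingularOver K (G.induce S) ∨ IsSingularOver K (G.induce T) := by
  classical
  have hsub (S : Set V) : (G.adjMatrix K).submatrix (Subtype.val : S → V) Subtype.val =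
      (G.induce S).adjMatrix K :=
    (Embedding.induce S).submatrix_adjMatrix K
  rw [isSingularOver_iff_det_eq_zero, det_eq_mul_of_forall_exists_mulVec hST h, mul_eq_zero,
    hsub, hsub, isSingularOver_iff_det_eq_zero, isSingularOver_iff_det_eq_zero]

theorem exists_adjMatrix_mulVec_eq_single_of_isBipartite [Field K] [Fintype V] [DecidableEq V]
    {G : SimpleGraph V} [DecidableRel G.Adj] (hG : G.IsBipartite) {v : V}
    (hv : v ∉ nullSupportOver K G) :
    ∃ y : V → K, G.adjMatrix K *ᵥ y = Pi.single v 1 ∧ y v = 0 := by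
  obtain ⟨c⟩ := hG
  obtain ⟨y, hy⟩ : ∃ y, y ᵥ* G.adjMatrix K = Pi.single v 1 :=
    exists_vecMul_eq_single fun x hx => by
      by_contra hxv
      exact hv (mem_nullSupportOver_iff.2 ⟨x, hx, hxv⟩)
  -- Dropping the colour class of `v` from `y` does not affect the equations at that class.
  refine ⟨fun u => if c u = c v then 0 else y u, funext fun u => ?_, if_pos rfl⟩
  rw [adjMatrix_mulVec_apply]
  by_cases hu : c u = c v
  · rw [← hy, adjMatrix_vecMul_apply]
    refine Finset.sum_congr rfl fun w hw => if_neg fun hw' => ?_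
    exact c.valid ((G.mem_neighborFinset u w).1 hw) (hu.trans hw'.symm)
  · rw [Pi.single_eq_of_ne fun h => hu (congrArg c h)]
    refine Finset.sum_eq_zero fun w hw => if_pos ?_
    have := c.valid ((G.mem_neighborFinset u w).1 hw)
    omega

end Singular

section Attached

variable {V K : Type*} {G : SimpleGraph V} {S : Set V} {v : V}

/-- The subgraph of `G` induced by `S` is attached to the rest of `G` at the vertex `v` of `S`:
every edge of `G` that leaves `S` starts at `v`. -/
structure IsAttachedAt (G : SimpleGraph V) (S : Set V) (v : V) : Prop where
  mem : v ∈ S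
  mem_of_adj : ∀ ⦃u⦄, u ∈ S → u ≠ v → ∀ ⦃w⦄, G.Adj u w → w ∈ S

theorem IsAttachedAt.eq_of_adj (h : IsAttachedAt G S v) {u w : V} (hu : u ∈ S) (hw : w ∉ S)
    (huw : G.Adj u w) : u = v := by
  by_contra hne
  exact hw (h.mem_of_adj hu hne huw)

theorem IsAttachedAt.adjMatrix_mulVec_extend [NonAssocSemiring K] [Fintype V] [DecidableRel G.Adj]
    [Fintype S] (h : IsAttachedAt G S v) (y : S → K) :
    G.adjMatrix K *ᵥ Function.extend Subtype.val y 0 =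
      Function.extend Subtype.val ((G.induce S).adjMatrix K *ᵥ y)
        fun u => if G.Adj u v then y (⟨v, h.mem⟩ : S) else 0 := by
  classical
  have hsum (u : V) : (G.adjMatrix K *ᵥ Function.extend Subtype.val y 0) u =
      ∑ w : S, if G.Adj u w then y w else 0 := by
    have hout : ∀ w ∉ Set.range (Subtype.val : S → V),
        G.adjMatrix K u w * Function.extend Subtype.val y 0 w = 0 := fun w hw => by
      rw [Function.extend_apply' _ _ _ hw, Pi.zero_apply, mul_zero]
    rw [mulVec, dotProduct, ← Fintype.sum_of_injective _ Subtype.val_injective _ _ hout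
      fun w => rfl]
    simp
  funext u
  rw [hsum]
  by_cases hu : u ∈ S
  · rw [Subtype.val_injective.extend_apply _ _ ⟨u, hu⟩]
    simp [mulVec, dotProduct]
  · rw [Function.extend_apply' _ _ _ (by simpa using hu)]
    refine Fintype.sum_eq_single (⟨v, h.mem⟩ : S) fun w hw => if_neg fun huw => hw ?_
    exact Subtype.ext (h.eq_of_adj w.2 hu huw.symm)

theorem IsAttachedAt.isSingularOver_iff_of_notMem_nullSupportOver [Field K] [Finite V]
    (h : IsAttachedAt G S v) (hbip : (G.induce S).IsBipartite)
    (hv : (⟨v, h.mem⟩ : S) ∉ nullSupportOver K (G.induce S)) :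
    IsSingularOver K G ↔ IsSingularOver K (G.induce S) ∨ IsSingularOver K (G.induce Sᶜ) := by
  classical
  cases nonempty_fintype V
  obtain ⟨y, hy, hyv⟩ := exists_adjMatrix_mulVec_eq_single_of_isBipartite hbip hv
  have hAy : G.adjMatrix K *ᵥ Function.extend Subtype.val y 0 = Pi.single v 1 := by
    rw [h.adjMatrix_mulVec_extend, hy, hyv]
    funext u
    by_cases hu : u ∈ S
    · rw [Subtype.val_injective.extend_apply _ _ ⟨u, hu⟩]
      simp [Pi.single_apply]
    · rw [Function.extend_apply' _ _ _ (by simpa using hu), ite_self,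
        Pi.single_eq_of_ne (ne_of_mem_of_not_mem h.mem hu).symm]
  rw [or_comm]
  -- Subtracting the extension of `y` from the unit vector at `w` cancels the edge from `w` to `v`.
  refine isSingularOver_iff_or_of_forall_exists_mulVec isCompl_compl.symm fun w hw => ?_
  refine ⟨Pi.single w 1 - G.adjMatrix K v w • Function.extend Subtype.val y 0,
    fun u hu => ?_, ?_⟩
  · have hyu : Function.extend Subtype.val y 0 u = 0 :=
      Function.extend_apply' _ _ _ (by simpa using hu)
    simp [hyu, ite_apply]
  rw [mulVec_sub, mulVec_smul, hAy, mulVec_single_one]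
  funext u
  by_cases hu : u ∈ S
  · obtain rfl | huv := eq_or_ne u v
    · simp [hu, ite_apply]
    · have huw : ¬ G.Adj u w := fun huw => huv (h.eq_of_adj hu hw huw)
      simp [hu, huv, huw, ite_apply]
  · simp [hu, (ne_of_mem_of_not_mem h.mem hu).symm, ite_apply]

theorem isSingularOver_iff_of_forall_mem_nullSupportOver [Field K] [Finite V] {D : Set V}
    {P : V → Set V} (hP : ∀ v ∈ D, IsAttachedAt G (P v) v) (hPD : ∀ v ∈ D, P v ∩ D ⊆ {v})
    (hN : ∀ v ∈ D, G.neighborSet v ⊆ P v ∪ D)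
    (hsupp : ∀ v (hv : v ∈ D), (⟨v, (hP v hv).mem⟩ : P v) ∈ nullSupportOver K (G.induce (P v))) :
    IsSingularOver K G ↔ IsSingularOver K (G.induce D) ∨ IsSingularOver K (G.induce Dᶜ) := by
  classical
  cases nonempty_fintype V
  refine isSingularOver_iff_or_of_forall_exists_mulVec isCompl_compl fun v hv => ?_
  obtain ⟨x, hx, hxv⟩ := mem_nullSupportOver_iff.1 (hsupp v hv)
  set c := x ⟨v, (hP v hv).mem⟩
  have hPv {u : V} (hu : u ∈ P v) (huD : u ∈ D) : u = v := hPD v hv ⟨hu, huD⟩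
  -- The rescaled null vector of `P v` has the same image on `D` as the unit vector at `v`.
  refine ⟨Function.extend Subtype.val (c⁻¹ • x) 0, fun u hu => ?_, ?_⟩
  · by_cases huP : u ∈ P v
    · obtain rfl := hPv huP hu
      rw [Subtype.val_injective.extend_apply _ _ ⟨u, huP⟩, Pi.single_eq_same]
      exact inv_mul_cancel₀ hxv
    · rw [Function.extend_apply' _ _ _ (by simpa using huP),
        Pi.single_eq_of_ne (ne_of_mem_of_not_mem (hP v hv).mem huP).symm, Pi.zero_apply]
  · rw [(hP v hv).adjMatrix_mulVec_extend, mulVec_smul, hx, smul_zero, mulVec_single_one]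
    funext u
    by_cases huP : u ∈ P v
    · rw [Subtype.val_injective.extend_apply _ _ ⟨u, huP⟩]
      by_cases huD : u ∈ D
      · have huv : ¬ G.Adj u v := fun h => h.ne (hPv huP huD)
        simp [huD, huv]
      · simp [huD]
    · rw [Function.extend_apply' _ _ _ (by simpa using huP)]
      by_cases huD : u ∈ D
      · simp [huD, c, inv_mul_cancel₀ hxv]
      · have huv : ¬ G.Adj u v := fun huv => (hN v hv huv.symm).elim huP huD
        simp [huD, huv]

end Attached

section Matching

variable {V : Type*} {G : SimpleGraph V}

theorem hasPerfectMatching_iff_exists_involution :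
    G.HasPerfectMatching ↔ ∃ f : V → V, ∀ v, G.Adj v (f v) ∧ f (f v) = v := by
  constructor
  · rintro ⟨M, hM⟩
    rw [Subgraph.isPerfectMatching_iff] at hM
    choose f hf huniq using hM
    exact ⟨f, fun v => ⟨(hf v).adj_sub, (huniq (f v) v (hf v).symm).symm⟩⟩
  · rintro ⟨f, hf⟩
    refine ⟨⟨Set.univ, fun v w => w = f v, ?_, by simp, ⟨?_⟩⟩, ?_⟩
    · rintro v w rfl
      exact (hf v).1
    · rintro v w rfl
      exact (hf v).2.symm
    · rw [Subgraph.isPerfectMatching_iff]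
      exact fun v => ⟨f v, rfl, fun w hw => hw⟩

theorem hasPerfectMatching_induce_iff {S : Set V} :
    (G.induce S).HasPerfectMatching ↔
      ∃ f : V → V, ∀ v ∈ S, f v ∈ S ∧ G.Adj v (f v) ∧ f (f v) = v := by
  classical
  rw [hasPerfectMatching_iff_exists_involution]
  constructor
  · rintro ⟨f, hf⟩
    refine ⟨fun v => if h : v ∈ S then f ⟨v, h⟩ else v, fun v hv => ?_⟩
    obtain ⟨hadj, hinv⟩ := hf ⟨v, hv⟩
    simp only [hv, dif_pos, Subtype.coe_prop, hinv, and_true, true_and]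
    exact hadj
  · rintro ⟨f, hf⟩
    exact ⟨fun v => ⟨f v, (hf v v.2).1⟩, fun v => ⟨(hf v v.2).2.1, Subtype.ext (hf v v.2).2.2⟩⟩

theorem hasPerfectMatching_iff_forall_connectedComponent :
    G.HasPerfectMatching ↔
      ∀ T : G.ConnectedComponent, T.toSimpleGraph.HasPerfectMatching := by
  have hcomp (T : G.ConnectedComponent) : T.toSimpleGraph.HasPerfectMatching ↔
      ∃ f : V → V, ∀ v ∈ T.supp, f v ∈ T.supp ∧ G.Adj v (f v) ∧ f (f v) = v :=
    hasPerfectMatching_induce_iff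
  simp only [hcomp]
  rw [hasPerfectMatching_iff_exists_involution]
  constructor
  · rintro ⟨f, hf⟩ T
    exact ⟨f, fun v hv => ⟨(T.mem_supp_congr_adj (hf v).1).1 hv, hf v⟩⟩
  · intro h
    choose f hf using h
    refine ⟨fun v => f (G.connectedComponentMk v) v, fun v => ?_⟩
    obtain ⟨hmem, hadj, hinv⟩ := hf (G.connectedComponentMk v) v rfl
    rw [ConnectedComponent.mem_supp_iff] at hmem
    simp only [hmem, hinv, hadj, and_self]

theorem hasPerfectMatching_iff_of_neighborSet_eq_singleton {v w : V}
    (h : G.neighborSet v = {w}) :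
    G.HasPerfectMatching ↔ (G.induce {v, w}ᶜ).HasPerfectMatching := by
  classical
  rw [hasPerfectMatching_induce_iff, hasPerfectMatching_iff_exists_involution]
  have hvw : G.Adj v w := by rw [← mem_neighborSet, h, Set.mem_singleton_iff]
  constructor
  · rintro ⟨f, hf⟩
    have hfv : f v = w := h.le (hf v).1
    have hfw : f w = v := by rw [← hfv, (hf v).2]
    refine ⟨f, fun u hu => ⟨?_, hf u⟩⟩
    rintro (hfu | hfu)
    · exact hu (Or.inr (by rw [Set.mem_singleton_iff, ← (hf u).2, hfu, hfv]))
    · exact hu (Or.inl (by rw [← (hf u).2, hfu, hfw]))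
  · rintro ⟨f, hf⟩
    refine ⟨fun u => if u = v then w else if u = w then v else f u, fun u => ?_⟩
    obtain rfl | huv := eq_or_ne u v
    · simp [hvw, hvw.ne']
    obtain rfl | huw := eq_or_ne u w
    · simp [hvw.symm, hvw.ne']
    obtain ⟨hmem, hadj, hinv⟩ := hf u (by simp [huv, huw])
    obtain ⟨hfv, hfw⟩ : f u ≠ v ∧ f u ≠ w := by simpa using hmem
    simp [huv, huw, hfv, hfw, hadj, hinv]

end Matching

section Forest

variable {V K : Type*} {G : SimpleGraph V}

theorem exists_subsingleton_neighborSet_of_isAcyclic [Finite V] [Nonempty V]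
    (hG : G.IsAcyclic) : ∃ v, (G.neighborSet v).Subsingleton := by
  classical
  have := Fintype.ofFinite V
  obtain ⟨v₀⟩ := ‹Nonempty V›
  let T := G.connectedComponentMk v₀
  have hmem {v a : V} (hv : v ∈ T.supp) (hva : G.Adj v a) : a ∈ T.supp :=
    (T.mem_supp_congr_adj hva).1 hv
  obtain hT | hT := subsingleton_or_nontrivial T.supp
  · refine ⟨v₀, fun a ha b hb => ?_⟩
    exact congrArg Subtype.val (hT.elim ⟨a, hmem rfl ha⟩ ⟨b, hmem rfl hb⟩)
  · obtain ⟨v, hv⟩ := (hG.isTree_connectedComponent T).exists_vert_degree_one_of_nontrivial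
    rw [degree_eq_one_iff_existsUnique_adj] at hv
    refine ⟨v, fun a ha b hb => ?_⟩
    exact congrArg Subtype.val (hv.unique (y₁ := ⟨a, hmem v.2 ha⟩) (y₂ := ⟨b, hmem v.2 hb⟩) ha hb)

theorem isSingularOver_of_neighborSet_eq_empty [CommRing K] [IsDomain K] [Finite V] {v : V}
    (hv : G.neighborSet v = ∅) : IsSingularOver K G := by
  classical
  cases nonempty_fintype V
  refine (isSingularOver_iff_exists_mulVec_eq_zero G).2
    ⟨Pi.single v 1, Pi.single_ne_zero_iff.2 one_ne_zero, funext fun u => ?_⟩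
  have huv : ¬ G.Adj u v := fun huv => hv.le (show u ∈ G.neighborSet v from huv.symm)
  simp [huv]

theorem not_isSingularOver_induce_pair [CommRing K] [IsDomain K] {v w : V} (h : G.Adj v w) :
    ¬ IsSingularOver K (G.induce {v, w}) := by
  classical
  rw [isSingularOver_iff_exists_mulVec_eq_zero]
  rintro ⟨x, hx0, hx⟩
  have hv : (G.induce {v, w}).neighborFinset ⟨v, by simp⟩ = {⟨w, by simp⟩} := by
    ext ⟨u, rfl | rfl⟩ <;> simp [h, Subtype.ext_iff, h.ne]
  have hw : (G.induce {v, w}).neighborFinset ⟨w, by simp⟩ = {⟨v, by simp⟩} := by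
    ext ⟨u, rfl | rfl⟩ <;> simp [h.symm, Subtype.ext_iff, h.ne']
  refine hx0 (funext ?_)
  rintro ⟨u, rfl | rfl⟩
  · simpa [adjMatrix_mulVec_apply, hw] using congrFun hx ⟨w, by simp⟩
  · simpa [adjMatrix_mulVec_apply, hv] using congrFun hx ⟨v, by simp⟩

theorem isSingularOver_iff_of_neighborSet_eq_singleton [Field K] [Finite V] {v w : V}
    (hv : G.neighborSet v = {w}) :
    IsSingularOver K G ↔ IsSingularOver K (G.induce {v, w}ᶜ) := by
  have hvw : G.Adj v w := by rw [← mem_neighborSet, hv, Set.mem_singleton_iff]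
  have hatt : IsAttachedAt G {v, w} w := by
    refine ⟨by simp, ?_⟩
    rintro u (rfl | rfl) huw x hux
    · exact Or.inr (hv.le hux)
    · exact absurd rfl huw
  have hbip : (G.induce {v, w}).IsBipartite :=
    (IsAcyclic.of_card_le_two (Set.encard_pair hvw.ne).le).isBipartite
  have hsing := not_isSingularOver_induce_pair (K := K) hvw
  rw [hatt.isSingularOver_iff_of_notMem_nullSupportOver hbip
    fun hw => hsing (isSingularOver_of_mem_nullSupportOver hw), or_iff_right hsing]

theorem isSingularOver_iff_not_hasPerfectMatching_of_isAcyclic [Field K] [Finite V]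
    (hG : G.IsAcyclic) : IsSingularOver K G ↔ ¬ G.HasPerfectMatching := by
  induction hn : Nat.card V using Nat.strong_induction_on generalizing V with
  | _ n ih =>
  subst hn
  obtain hV | hV := isEmpty_or_nonempty V
  · classical
    have := Fintype.ofFinite V
    refine iff_of_false ?_ (not_not_intro ?_)
    · rw [isSingularOver_iff_det_eq_zero, det_isEmpty]
      exact one_ne_zero
    · exact hasPerfectMatching_iff_exists_involution.2 ⟨id, hV.elim⟩
  obtain ⟨v, hv⟩ := exists_subsingleton_neighborSet_of_isAcyclic hG
  obtain hv | ⟨w, hw⟩ := hv.eq_empty_or_singleton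
  · refine iff_of_true (isSingularOver_of_neighborSet_eq_empty hv) fun hM => ?_
    obtain ⟨f, hf⟩ := hasPerfectMatching_iff_exists_involution.1 hM
    exact hv.le (hf v).1
  · rw [isSingularOver_iff_of_neighborSet_eq_singleton hw,
      hasPerfectMatching_iff_of_neighborSet_eq_singleton hw]
    exact ih _ (Finite.card_subtype_lt (x := v) (by simp)) (hG.induce _) rfl

end Forest

section Cycle

variable {K : Type*}

theorem cycleGraph_adjMatrix_mulVec_apply [NonAssocSemiring K] {n : ℕ} (x : Fin (n + 3) → K)
    (i : Fin (n + 3)) :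
    ((cycleGraph (n + 3)).adjMatrix K *ᵥ x) (i + 1) = x i + x (i + 1 + 1) := by
  have hne : i ≠ i + 1 + 1 := by
    rw [add_assoc, ne_comm, Ne, add_eq_left, Fin.ext_iff, Fin.val_add, Fin.val_one,
      Nat.mod_eq_of_lt (by omega)]
    exact two_ne_zero
  rw [adjMatrix_mulVec_apply, cycleGraph_neighborFinset, add_sub_cancel_right,
    Finset.sum_pair hne]

theorem cycleGraph_adjMatrix_mulVec_eq_zero_iff [NonAssocRing K] {n : ℕ} {x : Fin (n + 3) → K} :
    (cycleGraph (n + 3)).adjMatrix K *ᵥ x = 0 ↔ ∀ i, x (i + 1 + 1) = -x i := by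
  rw [funext_iff, ← (Equiv.addRight (1 : Fin (n + 3))).forall_congr_right]
  refine forall_congr' fun i => ?_
  rw [Equiv.coe_addRight, cycleGraph_adjMatrix_mulVec_apply, Pi.zero_apply,
    add_eq_zero_iff_eq_neg']

theorem exists_odd_dvd_two_mul_of_not_four_dvd {n : ℕ} (hn : ¬ 4 ∣ n) :
    ∃ k, Odd k ∧ n ∣ 2 * k := by
  obtain ⟨k, hk⟩ | hodd := Nat.even_or_odd n
  · refine ⟨k, Nat.not_even_iff_odd.1 ?_, ⟨1, by omega⟩⟩
    rintro ⟨j, hj⟩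
    exact hn ⟨j, by omega⟩
  · exact ⟨n, hodd, Nat.dvd_mul_left n 2⟩

theorem apply_add_two_mul_nsmul_of_apply_add_add_eq_neg {A R : Type*} [AddMonoid A] [Ring R]
    {x : A → R} {a : A} (hx : ∀ i, x (i + a + a) = -x i) (k : ℕ) (i : A) :
    x (i + (2 * k) • a) = (-1) ^ k * x i := by
  induction k with
  | zero => simp
  | succ k ih =>
    rw [mul_add_one, add_nsmul, two_nsmul, ← add_assoc, ← add_assoc, hx, ih, pow_succ', neg_one_mul,
      neg_mul]

theorem isSingularOver_cycleGraph_iff [CommRing K] [IsDomain K] [NeZero (2 : K)] {n : ℕ}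
    (hn : 3 ≤ n) :
    IsSingularOver K (cycleGraph n) ↔ 4 ∣ n := by
  obtain ⟨m, rfl⟩ := Nat.exists_eq_add_of_le' hn
  simp only [isSingularOver_iff_exists_mulVec_eq_zero, cycleGraph_adjMatrix_mulVec_eq_zero_iff]
  constructor
  · rintro ⟨x, hx0, hx⟩
    by_contra h4
    obtain ⟨k, hk, q, hq⟩ := exists_odd_dvd_two_mul_of_not_four_dvd h4
    have hzero : (2 * k) • (1 : Fin (m + 3)) = 0 := by
      have hcard : (m + 3) • (1 : Fin (m + 3)) = 0 := by
        simpa using card_nsmul_eq_zero (x := (1 : Fin (m + 3)))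
      rw [hq, mul_nsmul, hcard, nsmul_zero]
    refine hx0 (funext fun i => ?_)
    have hneg : x i = -x i := by
      simpa [hzero, hk.neg_one_pow] using apply_add_two_mul_nsmul_of_apply_add_add_eq_neg hx k i
    have h2 : (2 : K) * x i = 0 := by linear_combination hneg
    exact (mul_eq_zero.1 h2).resolve_left two_ne_zero
  · intro h4
    refine ⟨fun i => if i.val % 4 = 0 then 1 else if i.val % 4 = 2 then -1 else 0, fun h => ?_,
      fun i => ?_⟩
    · simpa using congrFun h 0
    · have hi : (i + 1 + 1).val % 4 = (i.val + 2) % 4 := by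
        rw [Fin.val_add, Nat.mod_mod_of_dvd _ h4, Nat.add_mod, Fin.val_add,
          Nat.mod_mod_of_dvd _ h4, Fin.val_one]
        omega
      simp only [hi]
      split_ifs <;> first | omega | simp

end Cycle

section CycleSubgraph

variable {V : Type*} {G : SimpleGraph V} {u : V} {p : G.Walk u u}

theorem cycleGraph_adj_iff_mod_eq {n : ℕ} (hn : 2 ≤ n) {i j : Fin n} :
    (cycleGraph n).Adj i j ↔ (i + 1) % n = (j : ℕ) ∨ (j + 1) % n = (i : ℕ) := by
  obtain ⟨m, rfl⟩ := Nat.exists_eq_add_of_le' hn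
  rw [cycleGraph_adj, sub_eq_iff_eq_add', sub_eq_iff_eq_add', or_comm, Fin.ext_iff, Fin.ext_iff,
    Fin.val_add, Fin.val_add, Fin.val_one, eq_comm, @eq_comm _ (i : ℕ)]

theorem nonempty_cycleGraph_iso_of_isCycle (hp : p.IsCycle) :
    Nonempty (cycleGraph p.length ≃g p.toSubgraph.coe) := by
  have h3 := hp.three_le_length
  have hinj : Set.InjOn p.getVert (Set.Iio p.length) := fun i hi j hj h =>
    hp.getVert_injOn' (Nat.le_sub_one_of_lt hi) (Nat.le_sub_one_of_lt hj) h
  have hmod {i : ℕ} (hi : i < p.length) : p.getVert ((i + 1) % p.length) = p.getVert (i + 1) := by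
    obtain h | h := (show i + 1 ≤ p.length from hi).lt_or_eq
    · rw [Nat.mod_eq_of_lt h]
    · rw [h, Nat.mod_self, Walk.getVert_zero, Walk.getVert_length]
  let f (i : Fin p.length) : p.toSubgraph.verts :=
    ⟨p.getVert i, p.mem_verts_toSubgraph.2 (p.getVert_mem_support i)⟩
  have hf : Function.Bijective f := by
    refine ⟨fun i j h => Fin.ext (hinj i.2 j.2 (congrArg Subtype.val h)), ?_⟩
    rintro ⟨v, hv⟩
    obtain ⟨i, rfl, hi⟩ := Walk.mem_support_iff_exists_getVert.1 (p.mem_verts_toSubgraph.1 hv)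
    obtain h | rfl := hi.lt_or_eq
    · exact ⟨⟨i, h⟩, rfl⟩
    · exact ⟨⟨0, by omega⟩, Subtype.ext (by simp [f])⟩
  refine ⟨⟨Equiv.ofBijective f hf, fun {i j} => ?_⟩⟩
  rw [cycleGraph_adj_iff_mod_eq (by omega), Equiv.ofBijective_apply, Equiv.ofBijective_apply,
    Subgraph.coe_adj, Walk.toSubgraph_adj_iff]
  have hlt (k : ℕ) : k % p.length < p.length := Nat.mod_lt _ (by omega)
  constructor
  · rintro ⟨k, hk, hkp⟩
    rw [← hmod hkp, Sym2.eq_iff] at hk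
    obtain ⟨hki, hkj⟩ | ⟨hkj, hki⟩ := hk
    · left
      rw [← hinj hkp i.2 hki, hinj (hlt _) j.2 hkj]
    · right
      rw [← hinj hkp j.2 hkj, hinj (hlt _) i.2 hki]
  · rintro (h | h)
    · exact ⟨i, by rw [← hmod i.2, h], i.2⟩
    · exact ⟨j, by rw [← hmod j.2, h, Sym2.eq_swap], j.2⟩

theorem ncard_edgeSet_toSubgraph_of_isCycle (hp : p.IsCycle) :
    p.toSubgraph.edgeSet.ncard = p.length := by
  classical
  have h : p.toSubgraph.edgeSet = (p.edges.toFinset : Set (Sym2 V)) := by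
    ext e
    simp
  rw [h, Set.ncard_coe_finset, List.toFinset_card_of_nodup hp.edges_nodup, p.length_edges]

theorem isSingularOver_coe_iff_of_isCycleGraph {K : Type*} [CommRing K] [IsDomain K]
    [NeZero (2 : K)] [Finite V] {C : G.Subgraph} (hC : C.IsCycleGraph) :
    IsSingularOver K C.coe ↔ 4 ∣ C.edgeSet.ncard := by
  obtain ⟨u, p, hp, rfl⟩ := hC
  obtain ⟨f⟩ := nonempty_cycleGraph_iso_of_isCycle hp
  rw [← isSingularOver_congr f, isSingularOver_cycleGraph_iff hp.three_le_length,
    ncard_edgeSet_toSubgraph_of_isCycle hp]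

end CycleSubgraph

section UniqueCycle

variable {V : Type*} {G : SimpleGraph V} {C : G.Subgraph} {u v w : V}

theorem nonempty_verts_of_isCycleGraph (hC : C.IsCycleGraph) : C.verts.Nonempty := by
  obtain ⟨u, p, -, rfl⟩ := hC
  exact ⟨u, p.start_mem_verts_toSubgraph⟩

theorem exists_walk_of_isCycleGraph (hC : C.IsCycleGraph) (hu : u ∈ C.verts) (hv : v ∈ C.verts) :
    ∃ q : G.Walk u v, ∀ e ∈ q.edges, e ∈ C.edgeSet := by
  classical
  obtain ⟨a, p, -, rfl⟩ := hC
  rw [Walk.mem_verts_toSubgraph] at hu hv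
  have hv' : v ∈ (p.rotate u hu).support := by rwa [Walk.mem_support_rotate_iff]
  refine ⟨(p.rotate u hu).takeUntil v hv', fun e he => ?_⟩
  rw [Walk.mem_edges_toSubgraph]
  exact (p.rotate_edges u hu).mem_iff.1 (Walk.edges_takeUntil_subset_edges _ _ he)

theorem eq_of_mem_pendantVerts (hw : w ∈ G.pendantVerts C v) (hwC : w ∈ C.verts) : w = v :=
  (G.isGreatest_pendantVerts C v).1.2.1 w hw hwC

theorem mem_pendantVerts_of_adj (hu : u ∈ G.pendantVerts C v) (huw : G.Adj u w)
    (hw : w ∉ C.verts) : w ∈ G.pendantVerts C v := by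
  obtain ⟨q, hq⟩ := hu
  refine ⟨q.concat huw, fun x hx hxC => ?_⟩
  rw [Walk.support_concat, List.mem_append, List.mem_singleton] at hx
  obtain hx | rfl := hx
  · exact hq x hx hxC
  · exact absurd hxC hw

theorem not_verts_subset_pendantVerts (hC : C.IsCycleGraph) (v : V) :
    ¬ C.verts ⊆ G.pendantVerts C v := by
  intro h
  obtain ⟨u, p, hp, rfl⟩ := hC
  have hadj := p.toSubgraph_adj_snd hp.not_nil
  exact hadj.ne ((eq_of_mem_pendantVerts (h hadj.fst_mem) hadj.fst_mem).trans
    (eq_of_mem_pendantVerts (h hadj.snd_mem) hadj.snd_mem).symm)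

variable (hG : ∃! C : G.Subgraph, C.IsCycleGraph) (hC : C.IsCycleGraph)
include hG hC

theorem mem_edges_of_not_adj (huv : G.Adj u v) (hn : ¬ C.Adj u v) (q : G.Walk u v) :
    s(u, v) ∈ q.edges := by
  refine isBridge_iff_forall_walk_mem_edges.1
    ((isBridge_iff_forall_cycle_notMem huv).2 fun a p hp he => hn ?_) q
  rwa [← hG.unique ⟨a, p, hp, rfl⟩ hC, ← Subgraph.mem_edgeSet, Walk.mem_edges_toSubgraph]

theorem isInduced_of_existsUnique_isCycleGraph : C.IsInduced := by
  intro u hu v hv huv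
  by_contra hn
  obtain ⟨q, hq⟩ := exists_walk_of_isCycleGraph hC hu hv
  exact hn (hq _ (mem_edges_of_not_adj hG hC huv hn q))

theorem isAcyclic_induce_of_not_verts_subset {S : Set V} (hS : ¬ C.verts ⊆ S) :
    (G.induce S).IsAcyclic := by
  intro u p hp
  have hinj : Function.Injective (Embedding.induce (G := G) S).toHom := Subtype.val_injective
  refine hS ?_
  rw [← hG.unique ⟨_, _, hp.map hinj, rfl⟩ hC]
  intro w hw
  rw [Walk.mem_verts_toSubgraph, Walk.support_map] at hw
  obtain ⟨y, -, rfl⟩ := List.mem_map.1 hw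
  exact y.2

theorem isAttachedAt_pendantVerts (hv : v ∈ C.verts) : IsAttachedAt G (G.pendantVerts C v) v := by
  refine ⟨G.mem_pendantVerts_self C v, fun w hw hwv u hwu => ?_⟩
  by_cases hu : u ∈ C.verts
  swap
  · exact mem_pendantVerts_of_adj hw hwu hu
  have hwC : w ∉ C.verts := fun h => hwv (eq_of_mem_pendantVerts hw h)
  obtain ⟨q, hq⟩ := hw
  obtain ⟨r, hr⟩ := exists_walk_of_isCycleGraph hC hv hu
  have hmem : s(w, u) ∈ (q.reverse.append r).edges :=
    mem_edges_of_not_adj hG hC hwu (fun h => hwC h.fst_mem) _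
  rw [Walk.edges_append, List.mem_append, Walk.edges_reverse, List.mem_reverse] at hmem
  obtain h | h := hmem
  · rw [hq u (q.snd_mem_support_of_mem_edges h) hu]
    exact G.mem_pendantVerts_self C v
  · exact absurd (C.edge_vert (hr _ h)) hwC

variable {K : Type*} [Field K] [Finite V]

theorem isSingularOver_iff_of_pendantRoot_notMem_nullSupportOver (hv : v ∈ C.verts)
    (hsupp : G.pendantRoot C v ∉ nullSupportOver K (G.pendantTree C v)) :
    IsSingularOver K G ↔ ¬ (G.pendantTree C v).HasPerfectMatching ∨
      ¬ (G.induce (G.pendantVerts C v)ᶜ).HasPerfectMatching := by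
  have htree : (G.induce (G.pendantVerts C v)).IsAcyclic :=
    isAcyclic_induce_of_not_verts_subset hG hC (not_verts_subset_pendantVerts hC v)
  have hrest : (G.induce (G.pendantVerts C v)ᶜ).IsAcyclic :=
    isAcyclic_induce_of_not_verts_subset hG hC fun h => h hv (G.mem_pendantVerts_self C v)
  rw [(isAttachedAt_pendantVerts hG hC hv).isSingularOver_iff_of_notMem_nullSupportOver
      htree.isBipartite hsupp,
    isSingularOver_iff_not_hasPerfectMatching_of_isAcyclic htree,
    isSingularOver_iff_not_hasPerfectMatching_of_isAcyclic hrest]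
  rfl

theorem isSingularOver_iff_of_forall_pendantRoot_mem_nullSupportOver [NeZero (2 : K)]
    (hsupp : ∀ v ∈ C.verts, G.pendantRoot C v ∈ nullSupportOver K (G.pendantTree C v)) :
    IsSingularOver K G ↔
      (∃ T : (G.induce C.vertsᶜ).ConnectedComponent, ¬ T.toSimpleGraph.HasPerfectMatching) ∨
        4 ∣ C.edgeSet.ncard := by
  obtain ⟨w, hw⟩ := nonempty_verts_of_isCycleGraph hC
  have hforest : (G.induce C.vertsᶜ).IsAcyclic :=
    isAcyclic_induce_of_not_verts_subset hG hC fun h => h hw hw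
  have hcycle : IsSingularOver K (G.induce C.verts) ↔ 4 ∣ C.edgeSet.ncard := by
    have hcoe : G.induce C.verts = C.coe := by
      ext a b
      exact (isInduced_of_existsUnique_isCycleGraph hG hC).adj.symm
    rw [hcoe, isSingularOver_coe_iff_of_isCycleGraph hC]
  have hN (v : V) : G.neighborSet v ⊆ G.pendantVerts C v ∪ C.verts := fun u hu =>
    or_iff_not_imp_right.2 (mem_pendantVerts_of_adj (G.mem_pendantVerts_self C v) hu)
  rw [isSingularOver_iff_of_forall_mem_nullSupportOver (P := G.pendantVerts C)
      (fun v => isAttachedAt_pendantVerts hG hC) (fun v _ u hu => eq_of_mem_pendantVerts hu.1 hu.2)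
      (fun v _ => hN v) hsupp,
    hcycle, isSingularOver_iff_not_hasPerfectMatching_of_isAcyclic hforest,
    hasPerfectMatching_iff_forall_connectedComponent, not_forall, or_comm]

end UniqueCycle

end SingularGraph

open SingularGraph

theorem theorem3_general {V K : Type*} [Field K] [NeZero (2 : K)] [Finite V] (G : SimpleGraph V)
    (hG : ∃! C : G.Subgraph, C.IsCycleGraph) (C : G.Subgraph) (hC : C.IsCycleGraph) :
    IsSingularOver K G ↔
      (∃ v ∈ C.verts, G.pendantRoot C v ∉ nullSupportOver K (G.pendantTree C v) ∧
        (¬ (G.pendantTree C v).HasPerfectMatching ∨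
          ¬ (G.induce (G.pendantVerts C v)ᶜ).HasPerfectMatching)) ∨
      ((∀ v ∈ C.verts, G.pendantRoot C v ∈ nullSupportOver K (G.pendantTree C v)) ∧
        ((∃ T : (G.induce C.vertsᶜ).ConnectedComponent, ¬ T.toSimpleGraph.HasPerfectMatching) ∨
          4 ∣ C.edgeSet.ncard)) := by
  have hnotMem := fun v => isSingularOver_iff_of_pendantRoot_notMem_nullSupportOver
    (K := K) (v := v) hG hC
  have hmem := isSingularOver_iff_of_forall_pendantRoot_mem_nullSupportOver (K := K) hG hC
  by_cases hall : ∀ v ∈ C.verts, G.pendantRoot C v ∈ nullSupportOver K (G.pendantTree C v)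
  · refine ⟨fun h => Or.inr ⟨hall, (hmem hall).1 h⟩, ?_⟩
    rintro (⟨v, hv, hvs, -⟩ | ⟨-, h⟩)
    · exact absurd (hall v hv) hvs
    · exact (hmem hall).2 h
  · refine ⟨fun h => ?_, ?_⟩
    · push Not at hall
      obtain ⟨v, hv, hvs⟩ := hall
      exact Or.inl ⟨v, hv, hvs, (hnotMem v hv hvs).1 h⟩
    · rintro (⟨v, hv, hvs, h⟩ | ⟨h, -⟩)
      · exact (hnotMem v hv hvs).2 h
      · exact absurd h hall

theorem theorem3 {V : Type*} [Finite V] (G : SimpleGraph V) (hG : G.IsUnicyclic)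
    (C : G.Subgraph) (hC : C.IsCycleGraph) :
    G.IsSingular ↔
      (∃ v ∈ C.verts, G.pendantRoot C v ∉ (G.pendantTree C v).nullSupport ∧
        (¬ (G.pendantTree C v).HasPerfectMatching ∨
          ¬ (G.induce (G.pendantVerts C v)ᶜ).HasPerfectMatching)) ∨
      ((∀ v ∈ C.verts, G.pendantRoot C v ∈ (G.pendantTree C v).nullSupport) ∧
        ((∃ T : (G.induce C.vertsᶜ).ConnectedComponent, ¬ T.toSimpleGraph.HasPerfectMatching) ∨
          4 ∣ C.edgeSet.ncard)) :=
  theorem3_general (K := ℝ) G hG.2 C hC
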